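/- For $d\in\mathbb{N}^+$ and $\Sigma\in\mathbb{R}$ let $N_d(\Sigma)=\#\{v\in\mathbb{Z}^d : |v|\le\Sigma\}$, where $|\cdot|$ is the Euclidean norm, and for $n\in\mathbb{N}$ let $r_3(n)=\#\{v\in\mathbb{Z}^3 : |v|^2=n\}$. Let $N_{3,0}=N_3$ and $N_{3,k}(\Sigma)=\int_0^\Sigma N_{3,k-1}(\sigma)\,d\sigma$ for $k\ge 1$. For each integer $j\ge 0$ the series $\sum_{n=1}^\infty r_3(n)n^{-2-j/2}$ converges absolutely; put $$C_j=\begin{cases}0 & j \text{ odd},\\ +(2j+4)(2\pi)^{-j-3}\sum_{n=1}^\infty r_3(n)n^{-2-j/2} & j\equiv 0 \pmod 4,\\ -(2j+4)(2\pi)^{-j-3}\sum_{n=1}^\infty r_3(n)n^{-2-j/2} & j\equiv 2 \pmod 4.\end{cases}$$ Then for each integer $k\ge 2$ there is a constant $A=A(k)$ such that, for all $\Sigma\ge 0$, $$\Big|N_{3,k}(\Sigma)-\frac{8\pi}{(3+k)!}\Sigma^{3+k}-\sum_{m=2}^{k-1}\frac{C_{k-1-m}}{m!}\Sigma^m\Big|\le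 A\,\Sigma .$$ Moreover, for each integer $k\ge 2$, there do not exist $\varepsilon>0$ and $\alpha\in\mathbb{R}$ such that $$N_{3,k}(\Sigma)=\frac{8\pi}{(3+k)!}\Sigma^{3+k}+\sum_{m=2}^{k-1}\frac{C_{k-1-m}}{m!}\Sigma^m+\alpha\Sigma+O(\Sigma^{1-\varepsilon})\qquad\text{as }\Sigma\to\infty .$$ -/

import Mathlib

namespace GaussSphere

/-- The lattice point counting function `N_d(S) = #{v ∈ ℤ^d : |v| ≤ S}`, with `|·|` the Euclidean
norm. The set is finite for every `S`, and empty for `S < 0`. -/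
noncomputable def latticeCount (d : ℕ) (S : ℝ) : ℕ :=
  Set.ncard {v : Fin d → ℤ |
    ‖(WithLp.toLp 2 (fun i => (v i : ℝ)) : EuclideanSpace ℝ (Fin d))‖ ≤ S}

/-- `r_d(n)`: the number of ways to write `n` as an ordered sum of `d` squares of integers. -/
noncomputable def sumSquaresCount (d n : ℕ) : ℕ :=
  Set.ncard {v : Fin d → ℤ | ∑ i, v i ^ 2 = (n : ℤ)}

/-- The iterated integrals `N_{3,k}` of `N_3`. -/
noncomputable def iteratedCount : ℕ → ℝ → ℝ
  | 0, S => (latticeCount 3 S : ℝ)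
  | k + 1, S => ∫ s in (0 : ℝ)..S, iteratedCount k s

/-- The `n`-th term `r_3(n) n^{-2-j/2}`, `n ≥ 1`, of the series in the definition of `C_j`. -/
noncomputable def coeffTerm (j : ℕ) (n : ℕ+) : ℝ :=
  (sumSquaresCount 3 (n : ℕ) : ℝ) * ((n : ℕ) : ℝ) ^ (-2 - (j : ℝ) / 2)

/-- The constants `C_j`. -/
noncomputable def coeff (j : ℕ) : ℝ :=
  if j % 4 = 0 then
    (2 * (j : ℝ) + 4) * (2 * Real.pi) ^ (-(j : ℤ) - 3) * ∑' n : ℕ+, coeffTerm j n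
  else if j % 4 = 2 then
    -((2 * (j : ℝ) + 4) * (2 * Real.pi) ^ (-(j : ℤ) - 3) * ∑' n : ℕ+, coeffTerm j n)
  else 0

/-- The polynomial `8π S^{3+k}/(3+k)! + ∑_{m=2}^{k-1} C_{k-1-m} S^m / m!`. -/
noncomputable def mainPart (k : ℕ) (S : ℝ) : ℝ :=
  8 * Real.pi / ((3 + k).factorial : ℝ) * S ^ (3 + k)
    + ∑ m ∈ Finset.Icc 2 (k - 1), coeff (k - 1 - m) / (m.factorial : ℝ) * S ^ m

end GaussSphere

/-! Integrating a step at `|v|` repeatedly from 0 turns it into a truncated power, so `N_{3,k}(S)`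
is the sum over `v ∈ ℤ³` of `(S - |v|)_+^k / k!` (`iteratedCount_eq_tsum`). For `k ≥ 2` Poisson
summation applies. The Fourier transform of a radial function in three dimensions is a
one-dimensional sine transform (`radialFourier_eq_sine`), and for this profile it is the
`(k+1)`-fold antiderivative of `r sin(wr)`, with `w = 2π|v|`: a polynomial plus an oscillating part
(`integral_sub_pow_mul_sin`).

Summed over frequencies, `v = 0` gives the volume term, the polynomials give the constants `C_j`,
and the oscillations give `-S * cosSum + sinSum`. Both series converge absolutely, their weights
decaying like `|v|^{-(k+2)}` and `|v|^{-(k+3)}` with `k + 2 > 3`. The resulting identity is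
`iteratedCount_sub_mainPart`, and boundedness of the two sums gives the linear bound.

If the error were `αS + O(S^{1-ε})`, dividing by `S` would force `cosSum` to converge. But its
correlation with a cosine of frequency `2π` and the common phase has a strictly positive mean: all
weights are nonnegative and the unit vectors contribute. A convergent function would have mean
correlation zero (`not_tendsto_cosSum`). -/

namespace GaussSphere

/-! ### Poisson summation via Fourier series on the torus -/

section Poisson

open MeasureTheory Set

variable {ι : Type*}

/-- The projection `ℝ^ι → (ℝ/ℤ)^ι`. -/
def toTorus (x : ι → ℝ) : UnitAddTorus ι := fun i => (x i : UnitAddCircle)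

lemma isOpenQuotientMap_toTorus : IsOpenQuotientMap (toTorus (ι := ι)) :=
  IsOpenQuotientMap.piMap fun _ => QuotientAddGroup.isOpenQuotientMap_mk

lemma toTorus_eq {x y : ι → ℝ} (h : toTorus x = toTorus y) :
    ∃ v : ι → ℤ, x = fun i => y i + v i := by
  have : ∀ i, ∃ n : ℤ, x i = y i + n := fun i => by
    have h1 : ((x i : ℝ) : UnitAddCircle) = y i := congrFun h i
    rw [← sub_eq_zero, ← AddCircle.coe_sub, AddCircle.coe_eq_zero_iff] at h1
    obtain ⟨n, hn⟩ := h1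
    exact ⟨n, by simp only [zsmul_eq_mul, mul_one] at hn; linarith⟩
  choose v hv using this
  exact ⟨v, funext hv⟩

/-- The half-open unit cube with lower corner `v`. -/
def unitCube (v : ι → ℤ) : Set (ι → ℝ) := {x | ∀ i, x i ∈ Ioc (v i : ℝ) (v i + 1)}

lemma mem_unitCube_iff {x : ι → ℝ} {v : ι → ℤ} : x ∈ unitCube v ↔ v = fun i => ⌈x i⌉ - 1 := by
  simp only [unitCube, mem_ofPred_eq, mem_Ioc, funext_iff]
  refine forall_congr' fun i => ?_
  have : v i = ⌈x i⌉ - 1 ↔ ⌈x i⌉ = v i + 1 := by constructor <;> intro h <;> omega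
  rw [this, Int.ceil_eq_iff]
  push_cast
  simp

/-- The sum of `f` over the translates of `x` by integer vectors. -/
noncomputable def periodization (f : (ι → ℝ) → ℂ) (x : ι → ℝ) : ℂ :=
  ∑' v : ι → ℤ, f fun i => x i + v i

lemma periodization_add_int (f : (ι → ℝ) → ℂ) (x : ι → ℝ) (v : ι → ℤ) :
    periodization f (fun i => x i + v i) = periodization f x := by
  rw [periodization, periodization, ← (Equiv.addLeft v).tsum_eq (fun w => f fun i => x i + w i)]
  refine tsum_congr fun w => congrArg f ?_
  funext i
  simp [add_assoc]

variable [Fintype ι]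

/-- The integer vectors with all coordinates bounded by `M` in absolute value. -/
noncomputable def intBox (ι : Type*) [Fintype ι] (M : ℤ) : Finset (ι → ℤ) := by
  classical exact Fintype.piFinset fun _ => Finset.Icc (-M) M

lemma mem_intBox {M : ℤ} {v : ι → ℤ} : v ∈ intBox ι M ↔ ∀ i, |v i| ≤ M := by
  simp [intBox, abs_le]

/-- Bounded support makes the periodization a finite sum over one index set valid for all `x` in a
bounded region, so continuity and interchange with integrals are elementary. -/
lemma translate_eq_zero {f : (ι → ℝ) → ℂ} {B : ℝ} (hB : ∀ x, f x ≠ 0 → ∀ i, |x i| ≤ B)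
    {R : ℝ} {x : ι → ℝ} (hx : ∀ i, |x i| ≤ R) {v : ι → ℤ} (hv : v ∉ intBox ι ⌈R + B⌉) :
    f (fun i => x i + v i) = 0 := by
  by_contra h
  refine hv (mem_intBox.2 fun i => ?_)
  have h1 := hB _ h i
  have h2 := hx i
  have h3 := Int.le_ceil (R + B)
  have h4 : |(v i : ℝ)| ≤ R + B := by
    rw [abs_le] at *
    constructor <;> linarith
  exact_mod_cast h4.trans h3

lemma periodization_eq_sum {f : (ι → ℝ) → ℂ} {B : ℝ} (hB : ∀ x, f x ≠ 0 → ∀ i, |x i| ≤ B)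
    {R : ℝ} {x : ι → ℝ} (hx : ∀ i, |x i| ≤ R) :
    periodization f x = ∑ v ∈ intBox ι ⌈R + B⌉, f fun i => x i + v i :=
  tsum_eq_sum fun _ hv => translate_eq_zero hB hx hv

lemma continuous_periodization {f : (ι → ℝ) → ℂ} (hf : Continuous f) {B : ℝ}
    (hB : ∀ x, f x ≠ 0 → ∀ i, |x i| ≤ B) : Continuous (periodization f) := by
  rw [continuous_iff_continuousAt]
  intro x₀
  have hR : {x : ι → ℝ | ‖x‖ < ‖x₀‖ + 1} ∈ nhds x₀ :=
    (isOpen_lt continuous_norm continuous_const).mem_nhds (by simp)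
  have : ContinuousAt (fun x : ι → ℝ => ∑ v ∈ intBox ι ⌈‖x₀‖ + 1 + B⌉,
      f fun i => x i + v i) x₀ :=
    (continuous_finsetSum _ fun v _ => hf.comp (by fun_prop)).continuousAt
  refine this.congr ?_
  filter_upwards [hR] with x hx
  exact (periodization_eq_sum hB fun i => (norm_le_pi_norm x i).trans hx.le).symm

/-- The periodization of a continuous compactly supported function, as a function on the torus. -/
noncomputable def torusPeriodization {f : (ι → ℝ) → ℂ} (hf : Continuous f) {B : ℝ}
    (hB : ∀ x, f x ≠ 0 → ∀ i, |x i| ≤ B) : C(UnitAddTorus ι, ℂ) where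
  toFun y := periodization f (Function.surjInv isOpenQuotientMap_toTorus.surjective y)
  continuous_toFun := by
    rw [isOpenQuotientMap_toTorus.isQuotientMap.continuous_iff]
    convert continuous_periodization hf hB using 1
    funext x
    obtain ⟨v, hv⟩ := toTorus_eq
      (Function.surjInv_eq isOpenQuotientMap_toTorus.surjective (toTorus x))
    simp only [Function.comp_apply]
    rw [hv, periodization_add_int]

lemma torusPeriodization_toTorus {f : (ι → ℝ) → ℂ} (hf : Continuous f) {B : ℝ}
    (hB : ∀ x, f x ≠ 0 → ∀ i, |x i| ≤ B) (x : ι → ℝ) :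
    torusPeriodization hf hB (toTorus x) = periodization f x := by
  obtain ⟨v, hv⟩ := toTorus_eq
    (Function.surjInv_eq isOpenQuotientMap_toTorus.surjective (toTorus x))
  change periodization f (Function.surjInv _ _) = _
  rw [hv, periodization_add_int]

lemma measurableSet_unitCube (v : ι → ℤ) : MeasurableSet (unitCube v) := by
  have : unitCube v = Set.pi univ fun i => Ioc (v i : ℝ) (v i + 1) := by
    ext; simp [unitCube]
  rw [this]
  exact MeasurableSet.univ_pi fun _ => measurableSet_Ioc

/-- Unfolding the integral of a periodization against a periodic function. -/
lemma setIntegral_mul_periodization {f : (ι → ℝ) → ℂ} (hf : Continuous f) {B : ℝ}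
    (hB : ∀ x, f x ≠ 0 → ∀ i, |x i| ≤ B) {e : (ι → ℝ) → ℂ} (he : Continuous e)
    (hper : ∀ x (v : ι → ℤ), e (fun i => x i + v i) = e x) :
    ∫ x in unitCube (0 : ι → ℤ), e x * periodization f x = ∫ x, e x * f x := by
  set T := intBox ι ⌈1 + B⌉
  have hcs : HasCompactSupport fun x => e x * f x := by
    refine HasCompactSupport.of_support_subset_isCompact (isCompact_closedBall (0 : ι → ℝ) |B|)
      fun x hx => ?_
    rw [mem_closedBall_zero_iff, pi_norm_le_iff_of_nonneg (abs_nonneg _)]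
    exact fun i => (hB x (right_ne_zero_of_mul hx) i).trans (le_abs_self B)
  have hint : Integrable fun x => e x * f x := (he.mul hf).integrable_of_hasCompactSupport hcs
  have h1 : ∫ x in unitCube (0 : ι → ℤ), e x * periodization f x
      = ∫ x in unitCube (0 : ι → ℤ), ∑ v ∈ T, (fun x => e x * f x) (x + fun i => (v i : ℝ)) := by
    refine setIntegral_congr_fun (measurableSet_unitCube _) fun x hx => ?_
    have hx' : ∀ i, |x i| ≤ 1 := fun i => by
      have := hx i
      simp only [Pi.zero_apply, Int.cast_zero, zero_add, mem_Ioc] at this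
      rw [abs_le]; constructor <;> linarith
    simp only
    rw [periodization_eq_sum hB hx', Finset.mul_sum]
    refine Finset.sum_congr rfl fun v _ => ?_
    rw [← hper x v]; rfl
  have h2 : ∀ v : ι → ℤ, ∫ x in unitCube (0 : ι → ℤ), (fun x => e x * f x) (x + fun i => (v i : ℝ))
      = ∫ x in unitCube v, e x * f x := fun v => by
    rw [← (measurePreserving_add_right volume (fun i => (v i : ℝ))).setIntegral_preimage_emb
      (measurableEmbedding_addRight _) _ (unitCube v)]
    congr 2
    ext x
    simp only [unitCube, mem_preimage, mem_ofPred_eq, Pi.add_apply, Pi.zero_apply, mem_Ioc]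
    refine forall_congr' fun i => ?_
    constructor <;> rintro ⟨h, h'⟩ <;> constructor <;> push_cast at * <;> linarith
  rw [h1, integral_finsetSum]
  swap
  · exact fun v _ => (hint.comp_add_right _).integrableOn
  simp_rw [h2]
  -- The cubes are disjoint, and those indexed by `T` cover the support of `f`.
  rw [← integral_biUnion_finset T (fun v _ => measurableSet_unitCube v)
    (fun v _ w _ hvw => ?_) (fun v _ => hint.integrableOn)]
  · rw [setIntegral_eq_integral_of_forall_compl_eq_zero]
    intro x hx
    by_contra h
    refine hx ?_
    simp only [mem_iUnion]
    refine ⟨fun i => ⌈x i⌉ - 1, ?_, mem_unitCube_iff.2 rfl⟩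
    refine mem_intBox.2 fun i => ?_
    have h1 := hB x (right_ne_zero_of_mul h) i
    have h2 := Int.ceil_lt_add_one (x i)
    have h3 := Int.le_ceil (x i)
    rw [abs_le] at h1 ⊢
    have h4 := Int.le_ceil (1 + B)
    constructor
    · have : -((⌈1 + B⌉ : ℤ) : ℝ) ≤ ((⌈x i⌉ - 1 : ℤ) : ℝ) := by push_cast; linarith
      exact_mod_cast this
    · have : ((⌈x i⌉ - 1 : ℤ) : ℝ) ≤ ((⌈1 + B⌉ : ℤ) : ℝ) := by push_cast; linarith
      exact_mod_cast this
  · rw [Function.onFun, Set.disjoint_left]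
    intro x hx hx'
    exact hvw ((mem_unitCube_iff.1 hx).trans (mem_unitCube_iff.1 hx').symm)

lemma mFourier_toTorus (n : ι → ℤ) (x : ι → ℝ) :
    UnitAddTorus.mFourier n (toTorus x)
      = Complex.exp (2 * Real.pi * Complex.I * ((∑ i, n i * x i : ℝ) : ℂ)) := by
  simp only [UnitAddTorus.mFourier, ContinuousMap.coe_mk, toTorus, fourier_coe_apply]
  rw [← Complex.exp_sum]
  congr 1
  push_cast
  rw [Finset.mul_sum]
  exact Finset.sum_congr rfl fun i _ => by ring

/-- **Poisson summation** for continuous functions of bounded support on `ℝ^ι`. -/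
theorem hasSum_fourier_of_boundedSupport {f : (ι → ℝ) → ℂ} (hf : Continuous f) {B : ℝ}
    (hB : ∀ x, f x ≠ 0 → ∀ i, |x i| ≤ B) {c : (ι → ℤ) → ℂ}
    (hc : ∀ n, c n = ∫ x, Complex.exp (-(2 * Real.pi * Complex.I * ((∑ i, n i * x i : ℝ) : ℂ)))
      * f x) (hs : Summable c) :
    HasSum c (∑' v : ι → ℤ, f fun i => (v i : ℝ)) := by
  set F := torusPeriodization hf hB
  have hcoef : UnitAddTorus.mFourierCoeff F = c := by
    funext n
    rw [UnitAddTorus.mFourierCoeff_eq_integral _ _ 0, hc]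
    have hcube : {x : ι → ℝ | ∀ i, x i ∈ Ioc ((0 : ι → ℝ) i) ((0 : ι → ℝ) i + 1)}
        = unitCube (0 : ι → ℤ) := by
      ext; simp [unitCube]
    rw [hcube, ← setIntegral_mul_periodization hf hB]
    · refine setIntegral_congr_fun (measurableSet_unitCube _) fun x _ => ?_
      change UnitAddTorus.mFourier (-n) (toTorus x) • F (toTorus x) = _
      rw [torusPeriodization_toTorus, mFourier_toTorus, smul_eq_mul]
      congr 2
      push_cast
      simp
    · fun_prop
    · intro x v
      rw [Complex.exp_eq_exp_iff_exists_int]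
      refine ⟨-∑ i, n i * v i, ?_⟩
      push_cast
      simp only [mul_add, Finset.sum_add_distrib]
      ring
  have h := UnitAddTorus.hasSum_mFourier_series_apply_of_summable (f := F) (hcoef ▸ hs)
    (toTorus 0)
  rw [hcoef, torusPeriodization_toTorus] at h
  convert h using 1
  · funext n
    rw [mFourier_toTorus]
    simp
  · simp [periodization]

end Poisson

/-! ### Fourier transforms of radial functions on `ℝ³` -/

section Radial

open MeasureTheory Set Filter Topology

/-- The integral of a radial function on `ℝ³` with profile `f` over the plane at height `x` is
`2π ∫_{|x|}^S s f(s) ds`. -/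
lemma integral_plane_slice {f : ℝ → ℝ} (hf : Continuous f) {S : ℝ} (hfS : ∀ r, S ≤ r → f r = 0)
    (x : ℝ) :
    ∫ y : EuclideanSpace ℝ (Fin 2), f (√(x ^ 2 + ‖y‖ ^ 2))
      = 2 * Real.pi * ∫ s in |x|..S, s * f s := by
  rw [integral_fun_norm_addHaar volume (fun r => f (√(x ^ 2 + r ^ 2)))]
  have hvol : volume.real (Metric.ball (0 : EuclideanSpace ℝ (Fin 2)) 1) = Real.pi := by
    simp [Measure.real, EuclideanSpace.volume_ball_fin_two, Real.pi_nonneg]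
  rw [hvol]
  have hmono : ∫ y in Ioi (0 : ℝ), y ^ (2 - 1) • f (√(x ^ 2 + y ^ 2))
      = ∫ s in |x|..S, s * f s := by
    set H : ℝ → ℝ := fun r => ∫ s in r..S, s * f s
    have hcont : Continuous fun s => s * f s := continuous_id.mul hf
    have hH : ∀ r, HasDerivAt H (-(r * f r)) r := fun r =>
      intervalIntegral.integral_hasDerivAt_left (hcont.intervalIntegrable _ _)
        hcont.aestronglyMeasurable.stronglyMeasurableAtFilter hcont.continuousAt
    have hle : ∀ r : ℝ, |r| ≤ √(x ^ 2 + r ^ 2) := fun r =>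
      Real.abs_le_sqrt (by nlinarith [sq_nonneg x])
    have hH0 : ∀ r, S ≤ r → H r = 0 := fun r hr => by
      refine (intervalIntegral.integral_congr (g := fun _ => 0) fun s hs => ?_).trans (by simp)
      rw [uIcc_of_ge hr] at hs
      simp [hfS s hs.1]
    have hHc : Continuous H := continuous_iff_continuousAt.2 fun r => (hH r).continuousAt
    have hgc : Continuous fun y => -(y * f (√(x ^ 2 + y ^ 2))) := by fun_prop
    have hint : Integrable fun y => -(y * f (√(x ^ 2 + y ^ 2))) := by
      refine hgc.integrable_of_hasCompactSupport
        (HasCompactSupport.of_support_subset_isCompact (isCompact_Icc (a := -S) (b := S)) ?_)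
      intro y hy
      rw [mem_Icc, ← abs_le]
      by_contra h
      exact hy (by simp [hfS _ ((not_le.1 h).le.trans (hle y))])
    -- The substitution `s = √(x² + y²)` has `s ds = y dy`, so `H` composed with it is an explicit
    -- antiderivative in `y`.
    have key := integral_Ioi_of_hasDerivAt_of_tendsto (a := 0) (m := 0)
      (f := fun y => H (√(x ^ 2 + y ^ 2))) (f' := fun y => -(y * f (√(x ^ 2 + y ^ 2))))
      (hHc.comp (by fun_prop)).continuousWithinAt (fun y (hy : 0 < y) => by
        have hpos : 0 < x ^ 2 + y ^ 2 := by positivity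
        have h1 : HasDerivAt (fun y => x ^ 2 + y ^ 2) (2 * y) y := by
          simpa using (hasDerivAt_pow 2 y).const_add (x ^ 2)
        refine ((hH _).comp y (h1.sqrt hpos.ne')).congr_deriv ?_
        have := Real.sqrt_pos.2 hpos
        field_simp) hint.integrableOn
      (tendsto_const_nhds.congr' (by
        filter_upwards [eventually_ge_atTop S] with y hy
        exact (hH0 _ ((hy.trans (le_abs_self y)).trans (hle y))).symm))
    rw [integral_neg] at key
    simp only [ne_eq, OfNat.ofNat_ne_zero, not_false_eq_true, zero_pow, add_zero,
      Real.sqrt_sq_eq_abs, zero_sub, neg_inj] at key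
    simpa using key
  simp only [finrank_euclideanSpace, Fintype.card_fin, smul_eq_mul, nsmul_eq_mul]
  rw [← hmono]
  push_cast
  simp only [smul_eq_mul]
  ring

/-- The Fourier integral of a radial function on `ℝ³` at `ξ`. -/
noncomputable def radialFourier (f : ℝ → ℝ) (ξ : EuclideanSpace ℝ (Fin 3)) : ℂ :=
  FourierTransform.fourier (fun x : EuclideanSpace ℝ (Fin 3) => (f ‖x‖ : ℂ)) ξ

/-- Reflection in the hyperplane orthogonal to `ξ - η` carries `ξ` to `η` and preserves the radial
function. -/
lemma radialFourier_eq_of_norm_eq (f : ℝ → ℝ) {ξ η : EuclideanSpace ℝ (Fin 3)} (h : ‖ξ‖ = ‖η‖) :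
    radialFourier f ξ = radialFourier f η := by
  set A := ((ℝ ∙ (ξ - η))ᗮ).reflection
  have hA : A ξ = η := Submodule.reflection_sub h
  rw [radialFourier, radialFourier, ← hA, ← Real.fourier_comp_linearIsometry A]
  have : (fun x : EuclideanSpace ℝ (Fin 3) => (f ‖x‖ : ℂ)) ∘ A = fun x => (f ‖x‖ : ℂ) := by
    funext x
    simp
  rw [this]

lemma radialFourier_eq_integral (f : ℝ → ℝ) (ξ : EuclideanSpace ℝ (Fin 3)) :
    radialFourier f ξ = ∫ x : Fin 3 → ℝ,
      Complex.exp (-(2 * Real.pi * Complex.I * ((∑ i, ξ i * x i : ℝ) : ℂ)))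
        * (f ‖(WithLp.toLp 2 x : EuclideanSpace ℝ (Fin 3))‖ : ℂ) := by
  rw [radialFourier, Real.fourier_eq', ← (PiLp.volume_preserving_toLp (Fin 3)).integral_comp
    (MeasurableEquiv.toLp 2 (Fin 3 → ℝ)).measurableEmbedding]
  refine integral_congr_ae (Eventually.of_forall fun x => ?_)
  simp only [smul_eq_mul, PiLp.inner_apply, RCLike.inner_apply, conj_trivial]
  congr 2
  push_cast
  ring

lemma radialFourier_zero (f : ℝ → ℝ) {S : ℝ} (hS : 0 ≤ S) (hfS : ∀ r, S ≤ r → f r = 0) :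
    radialFourier f 0 = ((4 * Real.pi * ∫ r in (0 : ℝ)..S, r ^ 2 * f r : ℝ) : ℂ) := by
  have h1 : radialFourier f 0
      = ((∫ x : EuclideanSpace ℝ (Fin 3), f ‖x‖ : ℝ) : ℂ) := by
    rw [radialFourier, Real.fourier_eq', ← integral_complex_ofReal]
    simp
  rw [h1, integral_fun_norm_addHaar volume f]
  have hvol : volume.real (Metric.ball (0 : EuclideanSpace ℝ (Fin 3)) 1) = Real.pi * 4 / 3 := by
    rw [Measure.real, EuclideanSpace.volume_ball_fin_three]
    simp
    positivity
  rw [hvol]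
  have h2 : ∫ y in Ioi (0 : ℝ), y ^ (3 - 1) • f y = ∫ r in (0 : ℝ)..S, r ^ 2 * f r := by
    rw [intervalIntegral.integral_of_le hS]
    refine (setIntegral_eq_of_subset_of_forall_sdiff_eq_zero measurableSet_Ioi
      Ioc_subset_Ioi_self fun r hr => ?_)
    simp only [Set.mem_sdiff, mem_Ioi, mem_Ioc, not_and, not_le] at hr
    simp [hfS r (hr.2 hr.1).le]
  simp only [finrank_euclideanSpace, Fintype.card_fin]
  rw [h2]
  simp only [smul_eq_mul, nsmul_eq_mul]
  push_cast
  ring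

lemma abs_le_of_radial_ne_zero {ι : Type*} [Fintype ι] {f : ℝ → ℝ} {S : ℝ}
    (hfS : ∀ r, S ≤ r → f r = 0) {x : ι → ℝ}
    (hx : f ‖(WithLp.toLp 2 x : EuclideanSpace ℝ ι)‖ ≠ 0) (i : ι) : |x i| ≤ S := by
  by_contra! h
  exact hx (hfS _ (h.le.trans (PiLp.norm_apply_le (WithLp.toLp 2 x : EuclideanSpace ℝ ι) i)))

/-- Slicing the Fourier integral of a radial function orthogonally to the frequency. -/
lemma radialFourier_eq_slice {f : ℝ → ℝ} (hf : Continuous f) {S : ℝ} (hS : 0 ≤ S)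
    (hfS : ∀ r, S ≤ r → f r = 0) (ξ : EuclideanSpace ℝ (Fin 3)) :
    radialFourier f ξ = ∫ x : ℝ, Complex.exp (-(2 * Real.pi * Complex.I * ((‖ξ‖ * x : ℝ) : ℂ)))
      * ((2 * Real.pi * ∫ s in |x|..S, s * f s : ℝ) : ℂ) := by
  -- With the frequency moved onto the first axis, the exponential is constant on each slice.
  have h0 : ‖ξ‖ = ‖(EuclideanSpace.single 0 ‖ξ‖ : EuclideanSpace ℝ (Fin 3))‖ := by simp
  rw [radialFourier_eq_of_norm_eq f h0, radialFourier_eq_integral]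
  set t := ‖ξ‖
  rw [← ((volume_preserving_piFinSuccAbove (fun _ : Fin 3 => ℝ) 0).symm _).integral_comp
    (MeasurableEquiv.measurableEmbedding _)]
  rw [Measure.volume_eq_prod, integral_prod]
  · refine integral_congr_ae (Eventually.of_forall fun x => ?_)
    simp only
    rw [← integral_plane_slice hf hfS x, ← integral_complex_ofReal, ← integral_const_mul,
      ← (PiLp.volume_preserving_toLp (Fin 2)).integral_comp
        (MeasurableEquiv.toLp 2 (Fin 2 → ℝ)).measurableEmbedding]
    refine integral_congr_ae (Eventually.of_forall fun y => ?_)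
    simp [EuclideanSpace.norm_eq, Fin.sum_univ_three]
    rw [Real.sq_sqrt (by positivity), ← add_assoc]
    rfl
  · refine ((volume_preserving_piFinSuccAbove (fun _ : Fin 3 => ℝ) 0).symm _).integrable_comp_emb
      (MeasurableEquiv.measurableEmbedding _) (g := fun z : Fin 3 → ℝ => Complex.exp (-(2 * Real.pi * Complex.I *
        ((∑ i, (EuclideanSpace.single 0 t : EuclideanSpace ℝ (Fin 3)) i * z i : ℝ) : ℂ)))
        * (f ‖(WithLp.toLp 2 z : EuclideanSpace ℝ (Fin 3))‖ : ℂ)) |>.2 ?_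
    refine Continuous.integrable_of_hasCompactSupport (by fun_prop) ?_
    refine HasCompactSupport.of_support_subset_isCompact (isCompact_closedBall (0 : Fin 3 → ℝ) S)
      fun z hz => ?_
    rw [mem_closedBall_zero_iff, pi_norm_le_iff_of_nonneg hS]
    exact abs_le_of_radial_ne_zero hfS (Complex.ofReal_ne_zero.1 (right_ne_zero_of_mul hz))

/-- The Fourier transform of a radial function on `ℝ³` is a sine transform of its profile. -/
theorem radialFourier_eq_sine {f : ℝ → ℝ} (hf : Continuous f) {S : ℝ} (hS : 0 ≤ S)
    (hfS : ∀ r, S ≤ r → f r = 0) {ξ : EuclideanSpace ℝ (Fin 3)} (hξ : ξ ≠ 0) :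
    radialFourier f ξ
      = ((2 / ‖ξ‖ * ∫ r in (0 : ℝ)..S, f r * (r * Real.sin (2 * Real.pi * ‖ξ‖ * r)) : ℝ) : ℂ) := by
  have ht : 0 < ‖ξ‖ := norm_pos_iff.2 hξ
  rw [radialFourier_eq_slice hf hS hfS]
  set t := ‖ξ‖
  set w := 2 * Real.pi * t with hw
  have hw0 : 0 < w := by positivity
  set H : ℝ → ℝ := fun r => ∫ s in r..S, s * f s
  have hcont : Continuous fun s => s * f s := continuous_id.mul hf
  have hH : ∀ r, HasDerivAt H (-(r * f r)) r := fun r =>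
    intervalIntegral.integral_hasDerivAt_left (hcont.intervalIntegrable _ _)
      hcont.aestronglyMeasurable.stronglyMeasurableAtFilter hcont.continuousAt
  have hH0 : ∀ r, S ≤ r → H r = 0 := fun r hr => by
    refine (intervalIntegral.integral_congr (g := fun _ => 0) fun s hs => ?_).trans (by simp)
    rw [uIcc_of_ge hr] at hs
    simp [hfS s hs.1]
  have hHc : Continuous H := continuous_iff_continuousAt.2 fun r => (hH r).continuousAt
  set E : ℝ → ℂ := fun x => Complex.exp (-(2 * Real.pi * Complex.I * ((t * x : ℝ) : ℂ))) * (H |x| : ℂ)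
  have hEc : Continuous E := by fun_prop
  have hEs : ∀ x, x ∉ Ioc (-S) S → E x = 0 := fun x hx => by
    have : S ≤ |x| := by
      by_contra! h
      exact hx ⟨(abs_lt.1 h).1, (abs_lt.1 h).2.le⟩
    simp [E, hH0 _ this]
  have h1 : ∫ x, E x = ∫ x in (-S)..S, E x := by
    rw [intervalIntegral.integral_of_le (by linarith),
      setIntegral_eq_integral_of_forall_compl_eq_zero hEs]
  have h2 : ∫ x in (-S)..S, E x = ((2 * ∫ x in (0:ℝ)..S, Real.cos (w * x) * H x : ℝ) : ℂ) := by
    rw [← intervalIntegral.integral_add_adjacent_intervals (b := 0)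
      (hEc.intervalIntegrable _ _) (hEc.intervalIntegrable _ _)]
    have h3 : ∫ x in (-S)..0, E x = ∫ x in (0:ℝ)..S, E (-x) := by
      rw [intervalIntegral.integral_comp_neg]; simp
    rw [h3, ← intervalIntegral.integral_add (by apply Continuous.intervalIntegrable; fun_prop)
      (hEc.intervalIntegrable _ _), ← intervalIntegral.integral_const_mul,
      ← intervalIntegral.integral_ofReal]
    refine intervalIntegral.integral_congr fun x hx => ?_
    rw [uIcc_of_le hS] at hx
    simp only [E, abs_neg, abs_of_nonneg hx.1]
    rw [← add_mul]
    push_cast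
    have hcos : 2 * (Complex.cos (w * x) * (H x : ℂ)) = (Complex.exp (w * x * Complex.I)
        + Complex.exp (-(w * x) * Complex.I)) * H x := by
      rw [Complex.cos]; ring
    rw [hcos]
    congr 3 <;> simp only [hw] <;> push_cast <;> ring_nf
  -- Integration by parts: the boundary terms vanish because `H S = 0` and `sin 0 = 0`.
  have h4 : ∫ x in (0:ℝ)..S, Real.cos (w * x) * H x
      = w⁻¹ * ∫ r in (0 : ℝ)..S, f r * (r * Real.sin (w * r)) := by
    have hsin : ∀ x, HasDerivAt (fun x => w⁻¹ * Real.sin (w * x)) (Real.cos (w * x)) x := fun x => by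
      have := ((Real.hasDerivAt_sin (w * x)).comp x ((hasDerivAt_id x).const_mul w)).const_mul w⁻¹
      refine this.congr_deriv ?_
      field_simp
    have := intervalIntegral.integral_mul_deriv_eq_deriv_mul (a := 0) (b := S)
      (u := H) (v := fun x => w⁻¹ * Real.sin (w * x)) (fun x _ => hH x) (fun x _ => hsin x)
      (by apply Continuous.intervalIntegrable; fun_prop)
      (by apply Continuous.intervalIntegrable; fun_prop)
    simp_rw [mul_comm (Real.cos _)]
    rw [this, hH0 S le_rfl, ← intervalIntegral.integral_const_mul]
    simp only [zero_mul, mul_zero, Real.sin_zero, sub_zero, zero_sub]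
    rw [← intervalIntegral.integral_neg]
    refine intervalIntegral.integral_congr fun x _ => ?_
    ring_nf
  have h5 : ∀ x : ℝ, Complex.exp (-(2 * Real.pi * Complex.I * ((t * x : ℝ) : ℂ)))
      * ((2 * Real.pi * H |x| : ℝ) : ℂ) = ((2 * Real.pi : ℝ) : ℂ) * E x := fun x => by
    simp only [E]
    push_cast
    ring
  rw [integral_congr_ae (Eventually.of_forall h5), integral_const_mul, h1, h2, h4,
    ← Complex.ofReal_mul]
  congr 1
  rw [hw]
  field_simp

end Radial

/-! ### Iterated antiderivatives and the closed form of the sine transform -/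

section IteratedIntegral

open MeasureTheory

/-- Cauchy's formula for repeated integration: the integral of `φ₀` against `(S - r)^k / k!` is the
`(k+1)`-st iterated antiderivative of `φ₀` vanishing at `0`. -/
lemma integral_sub_pow_mul {φ : ℕ → ℝ → ℝ} (h0 : Continuous (φ 0))
    (hφ : ∀ j r, HasDerivAt (φ (j + 1)) (φ j r) r) (hz : ∀ j, φ (j + 1) 0 = 0) (S : ℝ) (k : ℕ) :
    ∫ r in (0 : ℝ)..S, (S - r) ^ k / (k.factorial : ℝ) * φ 0 r = φ (k + 1) S := by
  have hc : ∀ j, Continuous (φ j) := by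
    rintro (_ | j)
    · exact h0
    · exact continuous_iff_continuousAt.2 fun r => (hφ j r).continuousAt
  -- By parts: the power vanishes at `S` and `φ (j + 1)` vanishes at 0.
  have hstep : ∀ k j, ∫ r in (0 : ℝ)..S, (S - r) ^ (k + 1) / ((k + 1).factorial : ℝ) * φ j r
      = ∫ r in (0 : ℝ)..S, (S - r) ^ k / (k.factorial : ℝ) * φ (j + 1) r := fun k j => by
    have hd : ∀ r, HasDerivAt (fun r => (S - r) ^ (k + 1) / ((k + 1).factorial : ℝ))
        (-((S - r) ^ k / (k.factorial : ℝ))) r := fun r => by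
      refine ((((hasDerivAt_id r).const_sub S).pow (k + 1)).div_const _).congr_deriv ?_
      rw [Nat.factorial_succ]
      push_cast
      have : (k.factorial : ℝ) ≠ 0 := by positivity
      simp
      field_simp
    rw [intervalIntegral.integral_mul_deriv_eq_deriv_mul (fun r _ => hd r) (fun r _ => hφ j r)
      (by apply Continuous.intervalIntegrable; fun_prop)
      ((hc j).intervalIntegrable _ _), hz j, ← sub_eq_zero]
    simp
  have : ∀ k j, ∫ r in (0 : ℝ)..S, (S - r) ^ k / (k.factorial : ℝ) * φ j r = φ (j + k + 1) S := by
    intro k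
    induction k with
    | zero =>
      intro j
      simp only [pow_zero, Nat.factorial_zero, Nat.cast_one, div_one, one_mul, add_zero]
      rw [intervalIntegral.integral_eq_sub_of_hasDerivAt (fun r _ => hφ j r)
        ((hc j).intervalIntegrable _ _), hz, sub_zero]
    | succ k ih =>
      intro j
      rw [hstep, ih]
      congr 1
      omega
  simpa using this k 0

lemma integral_sub_pow_mul_sq (S : ℝ) (k : ℕ) :
    ∫ r in (0 : ℝ)..S, (S - r) ^ k / (k.factorial : ℝ) * r ^ 2
      = 2 / ((3 + k).factorial : ℝ) * S ^ (3 + k) := by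
  have := integral_sub_pow_mul (φ := fun j r => 2 / ((j + 2).factorial : ℝ) * r ^ (j + 2))
    (by fun_prop) (fun j r => by
      refine ((hasDerivAt_pow (j + 1 + 2) r).const_mul _).congr_deriv ?_
      rw [show j + 1 + 2 = (j + 2) + 1 by ring, Nat.factorial_succ (j + 2)]
      push_cast
      have : ((j + 2).factorial : ℝ) ≠ 0 := by positivity
      have : (j : ℝ) + 2 + 1 ≠ 0 := by positivity
      field_simp) (fun j => by simp) S k
  rw [show 3 + k = k + 1 + 2 by ring]
  simpa using this

/-- The polynomial part of the `(k+1)`-fold iterated integral of `r sin (w r)`. -/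
noncomputable def polyPart (w : ℝ) (k : ℕ) (S : ℝ) : ℝ :=
  ∑ i ∈ Finset.range k, ((i : ℝ) + 2) * Real.cos (i * (Real.pi / 2)) * w⁻¹ ^ (3 + i)
    * (S ^ (k - 1 - i) / ((k - 1 - i).factorial : ℝ))

/-- The oscillating part of the `(k+1)`-fold iterated integral of `r sin (w r)`. -/
noncomputable def oscPart (w : ℝ) (k : ℕ) (S : ℝ) : ℝ :=
  -(S * w⁻¹ ^ (k + 1) * Real.cos (w * S - k * (Real.pi / 2)))
    + (k + 1) * w⁻¹ ^ (k + 2) * Real.sin (w * S - k * (Real.pi / 2))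

lemma hasDerivAt_polyPart (w : ℝ) (k : ℕ) (S : ℝ) :
    HasDerivAt (polyPart w (k + 1)) (polyPart w k S) S := by
  have h : ∀ i ∈ Finset.range k, HasDerivAt (fun S : ℝ => ((i : ℝ) + 2)
      * Real.cos (i * (Real.pi / 2)) * w⁻¹ ^ (3 + i)
      * (S ^ (k + 1 - 1 - i) / ((k + 1 - 1 - i).factorial : ℝ)))
      (((i : ℝ) + 2) * Real.cos (i * (Real.pi / 2)) * w⁻¹ ^ (3 + i)
      * (S ^ (k - 1 - i) / ((k - 1 - i).factorial : ℝ))) S := fun i hi => by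
    refine HasDerivAt.const_mul _ ?_
    obtain ⟨m, hm⟩ : ∃ m, k = i + 1 + m := ⟨k - (i + 1), by have := Finset.mem_range.1 hi; omega⟩
    rw [show k + 1 - 1 - i = m + 1 by omega, show k - 1 - i = m by omega]
    refine ((hasDerivAt_pow (m + 1) S).div_const _).congr_deriv ?_
    rw [Nat.factorial_succ]
    push_cast
    have : (m.factorial : ℝ) ≠ 0 := by positivity
    field_simp
  -- The new top term `i = k` carries `S ^ 0`: it is the constant of integration.
  have h2 := (HasDerivAt.fun_sum h).add_const
    (((k : ℝ) + 2) * Real.cos (k * (Real.pi / 2)) * w⁻¹ ^ (3 + k))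
  refine h2.congr_of_eventuallyEq (Filter.Eventually.of_forall fun S => ?_)
  simp [polyPart, Finset.sum_range_succ]

lemma cos_sub_succ (x : ℝ) (k : ℕ) :
    Real.cos (x - (k + 1 : ℕ) * (Real.pi / 2)) = Real.sin (x - k * (Real.pi / 2)) := by
  rw [← Real.cos_sub_pi_div_two]
  congr 1
  push_cast
  ring

lemma sin_sub_succ (x : ℝ) (k : ℕ) :
    Real.sin (x - (k + 1 : ℕ) * (Real.pi / 2)) = -Real.cos (x - k * (Real.pi / 2)) := by
  rw [← Real.sin_sub_pi_div_two]
  congr 1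
  push_cast
  ring

/-- Left unsimplified so that it covers both `k = 0`, where the derivative is `S sin(wS)`, and the
recursion in `k`. -/
lemma hasDerivAt_oscPart_aux {w : ℝ} (hw : w ≠ 0) (k : ℕ) (S : ℝ) :
    HasDerivAt (oscPart w k)
      (-(w⁻¹ ^ (k + 1) * Real.cos (w * S - k * (Real.pi / 2)))
        + S * w⁻¹ ^ k * Real.sin (w * S - k * (Real.pi / 2))
        + (k + 1) * w⁻¹ ^ (k + 1) * Real.cos (w * S - k * (Real.pi / 2))) S := by
  have harg : HasDerivAt (fun S => w * S - k * (Real.pi / 2)) w S := by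
    simpa using ((hasDerivAt_id S).const_mul w).sub_const (k * (Real.pi / 2))
  have hc := (Real.hasDerivAt_cos _).comp S harg
  have hs := (Real.hasDerivAt_sin _).comp S harg
  refine (((((hasDerivAt_id S).mul_const (w⁻¹ ^ (k + 1))).mul hc).neg).add
    (hs.const_mul ((k + 1) * w⁻¹ ^ (k + 2)))).congr_deriv ?_
  simp only [id, Function.comp_apply]
  linear_combination (S * w⁻¹ ^ k * Real.sin (w * S - k * (Real.pi / 2))
    + (k + 1) * w⁻¹ ^ (k + 1) * Real.cos (w * S - k * (Real.pi / 2))) * mul_inv_cancel₀ hw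

lemma hasDerivAt_oscPart_succ {w : ℝ} (hw : w ≠ 0) (k : ℕ) (S : ℝ) :
    HasDerivAt (oscPart w (k + 1)) (oscPart w k S) S := by
  refine (hasDerivAt_oscPart_aux hw (k + 1) S).congr_deriv ?_
  rw [cos_sub_succ, sin_sub_succ, oscPart]
  push_cast
  ring

/-- Closed form of the sine transform of `r ↦ (S - r)^k / k! * r` on `[0, S]`. -/
theorem integral_sub_pow_mul_sin {w : ℝ} (hw : w ≠ 0) (S : ℝ) (k : ℕ) :
    ∫ r in (0 : ℝ)..S, (S - r) ^ k / (k.factorial : ℝ) * (r * Real.sin (w * r))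
      = polyPart w k S + oscPart w k S := by
  refine integral_sub_pow_mul (φ := fun j => Nat.casesOn j (fun r => r * Real.sin (w * r))
    fun j r => polyPart w j r + oscPart w j r) (by fun_prop) ?_ ?_ S k
  · rintro (_ | j) r
    · have h := hasDerivAt_oscPart_aux hw 0 r
      simp only [polyPart, Finset.range_zero, Finset.sum_empty, zero_add]
      refine h.congr_deriv ?_
      simp
    · exact (hasDerivAt_polyPart w j r).add (hasDerivAt_oscPart_succ hw j r)
  · rintro (_ | j)
    · simp [polyPart, oscPart]
    · simp only [polyPart, Finset.sum_range_succ, oscPart]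
      -- At 0 only the constant term `i = j` of the polynomial survives; it cancels the sine term of
      -- `oscPart`. This determines the coefficients of `polyPart`.
      rw [Finset.sum_eq_zero fun i hi => ?_]
      · rw [sin_sub_succ]
        simp
        ring
      · have : j + 1 - 1 - i ≠ 0 := by have := Finset.mem_range.1 hi; omega
        rw [zero_pow this]
        simp

end IteratedIntegral

/-! ### The iterated counts as sums of truncated powers -/

section Count

open MeasureTheory Set

/-- The Euclidean norm of an integer vector. -/
noncomputable def intNorm {d : ℕ} (v : Fin d → ℤ) : ℝ :=
  ‖(WithLp.toLp 2 (fun i => (v i : ℝ)) : EuclideanSpace ℝ (Fin d))‖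

lemma intNorm_nonneg {d : ℕ} (v : Fin d → ℤ) : 0 ≤ intNorm v := norm_nonneg _

lemma intNorm_sq {d : ℕ} (v : Fin d → ℤ) : intNorm v ^ 2 = ((∑ i, v i ^ 2 : ℤ) : ℝ) := by
  simp [intNorm, EuclideanSpace.norm_sq_eq]

lemma finite_intNorm_le {d : ℕ} (T : ℝ) : {v : Fin d → ℤ | intNorm v ≤ T}.Finite := by
  refine (intBox (Fin d) ⌈T⌉).finite_toSet.subset fun v hv => ?_
  rw [Finset.mem_coe, mem_intBox]
  intro i
  have h1 := PiLp.norm_apply_le (WithLp.toLp 2 (fun i => (v i : ℝ)) : EuclideanSpace ℝ (Fin d)) i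
  have h2 : |(v i : ℝ)| ≤ ⌈T⌉ := (h1.trans hv).trans (Int.le_ceil T)
  exact_mod_cast h2

/-- The truncated power `(s - a)_+^k / k!`, with the convention `0^0 = 1` at `s = a`. -/
noncomputable def truncPow (k : ℕ) (a s : ℝ) : ℝ :=
  if a ≤ s then (s - a) ^ k / (k.factorial : ℝ) else 0

lemma monotone_truncPow (k : ℕ) (a : ℝ) : Monotone (truncPow k a) := by
  intro s t hst
  unfold truncPow
  split_ifs with h1 h2
  · have := sub_nonneg.2 h1
    gcongr
  · exact absurd (h1.trans hst) h2
  · have := sub_nonneg.2 (by assumption : a ≤ t)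
    positivity
  · rfl

lemma truncPow_succ_eq (k : ℕ) (a s : ℝ) :
    truncPow (k + 1) a s = max (s - a) 0 ^ (k + 1) / ((k + 1).factorial : ℝ) := by
  unfold truncPow
  split_ifs with h
  · rw [max_eq_left (sub_nonneg.2 h)]
  · rw [max_eq_right (by linarith)]; simp

lemma integral_truncPow (k : ℕ) {a : ℝ} (ha : 0 ≤ a) (S : ℝ) :
    ∫ s in (0 : ℝ)..S, truncPow k a s = truncPow (k + 1) a S := by
  -- Right derivatives are used because for `k = 0` the integrand jumps at `a`.
  rw [intervalIntegral.integral_eq_sub_of_hasDeriv_right (f := truncPow (k + 1) a) _ _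
    (monotone_truncPow k a).intervalIntegrable]
  · rw [truncPow_succ_eq _ _ 0, max_eq_right (by linarith)]
    simp
  · rw [funext (truncPow_succ_eq k a)]
    fun_prop
  · intro s _
    by_cases h : a ≤ s
    · have hd : HasDerivAt (fun s => (s - a) ^ (k + 1) / ((k + 1).factorial : ℝ))
          (truncPow k a s) s := by
        refine ((((hasDerivAt_id s).sub_const a).pow (k + 1)).div_const _).congr_deriv ?_
        rw [truncPow, if_pos h, Nat.factorial_succ]
        push_cast
        have : (k.factorial : ℝ) ≠ 0 := by positivity
        simp
        field_simp
      refine hd.hasDerivWithinAt.congr (fun t ht => ?_) ?_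
      · rw [truncPow, if_pos (h.trans (le_of_lt ht))]
      · rw [truncPow, if_pos h]
    · have hd : HasDerivAt (fun _ : ℝ => (0 : ℝ)) (truncPow k a s) s := by
        rw [truncPow, if_neg h]
        exact hasDerivAt_const _ _
      refine (hd.congr_of_eventuallyEq ?_).hasDerivWithinAt
      filter_upwards [gt_mem_nhds (not_le.1 h)] with t ht
      rw [truncPow, if_neg (not_le.2 ht)]

/-- Decoupling `T` from `S` lets one finite index set serve for every `s ∈ [0, S]` in the induction.
-/
lemma iteratedCount_eq_sum (k : ℕ) {S T : ℝ} (hS : 0 ≤ S) (hT : S ≤ T) :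
    iteratedCount k S
      = ∑ v ∈ (finite_intNorm_le (d := 3) T).toFinset, truncPow k (intNorm v) S := by
  induction k generalizing S with
  | zero =>
    simp only [iteratedCount, latticeCount, truncPow, pow_zero, Nat.factorial_zero, Nat.cast_one,
      div_one, Finset.sum_boole]
    congr 1
    rw [← Set.ncard_coe_finset]
    congr 1
    ext v
    simp only [Finset.coe_filter, Set.Finite.mem_toFinset, mem_ofPred_eq]
    exact ⟨fun h => ⟨le_trans h hT, h⟩, fun h => h.2⟩
  | succ k ih =>
    rw [iteratedCount, intervalIntegral.integral_congr (g := fun s =>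
      ∑ v ∈ (finite_intNorm_le (d := 3) T).toFinset, truncPow k (intNorm v) s) fun s hs => ?_,
      intervalIntegral.integral_finsetSum fun v _ => (monotone_truncPow _ _).intervalIntegrable]
    · exact Finset.sum_congr rfl fun v _ => integral_truncPow k (intNorm_nonneg v) S
    · rw [uIcc_of_le hS] at hs
      exact ih hs.1 (hs.2.trans hT)

lemma iteratedCount_eq_tsum (k : ℕ) {S : ℝ} (hS : 0 ≤ S) :
    iteratedCount k S = ∑' v : Fin 3 → ℤ, truncPow k (intNorm v) S := by
  rw [iteratedCount_eq_sum k hS le_rfl, tsum_eq_sum fun v hv => ?_]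
  simp only [Set.Finite.mem_toFinset, mem_ofPred_eq] at hv
  rw [truncPow, if_neg hv]

end Count

/-! ### Convergent lattice sums and the exact expansion -/

section LatticeSums

open MeasureTheory Set

lemma intNorm_zero {d : ℕ} : intNorm (0 : Fin d → ℤ) = 0 := by
  simp [intNorm, EuclideanSpace.norm_eq]

lemma one_le_intNorm {d : ℕ} {v : Fin d → ℤ} (hv : v ≠ 0) : 1 ≤ intNorm v := by
  rw [← one_le_sq_iff₀ (intNorm_nonneg v), intNorm_sq]
  obtain ⟨i, hi⟩ := Function.ne_iff.1 hv
  have h1 : 1 ≤ v i ^ 2 := by have := sq_pos_of_ne_zero (show v i ≠ 0 from hi); omega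
  have h2 := Finset.single_le_sum (f := fun i => v i ^ 2) (fun i _ => sq_nonneg _)
    (Finset.mem_univ i)
  exact_mod_cast h1.trans h2

lemma summable_inv_intNorm_pow {d p : ℕ} (hp : d < p) :
    Summable fun v : Fin d → ℤ => (intNorm v)⁻¹ ^ p := by
  set b := (EuclideanSpace.basisFun (Fin d) ℝ).toBasis
  set L := Submodule.span ℤ (Set.range b)
  have hL : Module.finrank ℤ L = d := by rw [ZLattice.rank ℝ]; simp
  have hs := ZLattice.summable_norm_pow_inv L p (by rw [hL]; exact hp)
  have hmem : ∀ v : Fin d → ℤ,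
      (WithLp.toLp 2 (fun i => (v i : ℝ)) : EuclideanSpace ℝ (Fin d)) ∈ L := fun v => by
    have : (WithLp.toLp 2 (fun i => (v i : ℝ)) : EuclideanSpace ℝ (Fin d))
        = ∑ i, v i • b i := by
      ext j
      simp [b, Finset.sum_apply, Pi.single_apply]
    rw [this]
    exact Submodule.sum_mem _ fun i _ =>
      Submodule.smul_mem _ _ (Submodule.subset_span (Set.mem_range_self i))
  refine hs.comp_injective (i := fun v => (⟨_, hmem v⟩ : L)) fun v w h => ?_
  have h' := congrArg (fun x : L => (x : EuclideanSpace ℝ (Fin d))) h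
  funext i
  have : (v i : ℝ) = w i := congrArg (fun x : EuclideanSpace ℝ (Fin d) => x i) h'
  exact_mod_cast this

/-- Grouping a lattice sum over `ℤ³` by the squared norm. -/
lemma hasSum_coeffTerm (j : ℕ) :
    HasSum (coeffTerm j) (∑' v : Fin 3 → ℤ, (intNorm v)⁻¹ ^ (4 + j)) := by
  set g : (Fin 3 → ℤ) → ℕ := fun v => (∑ i, v i ^ 2).toNat
  have hg : ∀ v n, g v = n ↔ ∑ i, v i ^ 2 = (n : ℤ) := fun v n => by
    have : 0 ≤ ∑ i, v i ^ 2 := Finset.sum_nonneg fun i _ => sq_nonneg _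
    simp only [g]
    omega
  have h := (summable_inv_intNorm_pow (d := 3) (p := 4 + j) (by omega)).hasSum.tsum_fiberwise g
  have hfib : ∀ n : ℕ, ∑' b : ↑(g ⁻¹' {n}), (intNorm (b : Fin 3 → ℤ))⁻¹ ^ (4 + j)
      = (sumSquaresCount 3 n : ℝ) * (n : ℝ) ^ (-2 - (j : ℝ) / 2) := fun n => by
    have hc : ∀ b : ↑(g ⁻¹' {n}), (intNorm (b : Fin 3 → ℤ))⁻¹ ^ (4 + j)
        = (n : ℝ) ^ (-2 - (j : ℝ) / 2) := fun b => by
      have hb := (hg b n).1 b.2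
      have h0 := intNorm_nonneg (b : Fin 3 → ℤ)
      have h1 : (n : ℝ) = intNorm (b : Fin 3 → ℤ) ^ (2 : ℝ) := by
        rw [Real.rpow_two, intNorm_sq, hb]
        simp
      rw [h1, ← Real.rpow_mul h0, inv_pow, ← Real.rpow_natCast, ← Real.rpow_neg h0]
      congr 1
      push_cast
      ring
    simp_rw [hc, tsum_const]
    rw [nsmul_eq_mul]
    congr 2
    rw [sumSquaresCount, ← Nat.card_coe_set_eq]
    congr 2
    ext v
    exact hg v n
  simp_rw [hfib] at h
  refine (Function.Injective.hasSum_iff PNat.coe_injective fun n hn => ?_).2 h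
  have : n = 0 := by
    by_contra hn0
    exact hn ⟨⟨n, Nat.pos_of_ne_zero hn0⟩, rfl⟩
  subst this
  -- Restricting to `n ≥ 1` loses nothing: zero to a nonzero real power is 0, matching the value
  -- `0⁻¹ = 0` at the origin.
  rw [Nat.cast_zero, Real.zero_rpow, mul_zero]
  have : (0 : ℝ) ≤ j := j.cast_nonneg
  linarith

lemma summable_coeffTerm (j : ℕ) : Summable (coeffTerm j) := (hasSum_coeffTerm j).summable

lemma cos_nat_mul_pi_div_two (j : ℕ) :
    Real.cos (j * (Real.pi / 2)) = if j % 4 = 0 then 1 else if j % 4 = 2 then -1 else 0 := by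
  have hj := Nat.div_add_mod j 4
  have hlt := Nat.mod_lt j (show 0 < 4 by norm_num)
  have h : (j : ℝ) * (Real.pi / 2)
      = ((j % 4 : ℕ) : ℝ) * (Real.pi / 2) + ((j / 4 : ℕ) : ℝ) * (2 * Real.pi) := by
    nth_rewrite 1 [← hj]
    push_cast
    ring
  rw [h, Real.cos_add_nat_mul_two_pi]
  interval_cases j % 4
  · simp
  · simp
  · simp [mul_div_cancel₀]
  · rw [show ((3 : ℕ) : ℝ) * (Real.pi / 2) = Real.pi / 2 + Real.pi by push_cast; ring,
      Real.cos_add_pi]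
    simp

/-- The factor `cos(jπ/2)` encodes the sign cases modulo 4 and is exactly what the sine transform
produces. -/
lemma coeff_eq (j : ℕ) :
    coeff j = (2 * (j : ℝ) + 4) * Real.cos (j * (Real.pi / 2)) * (2 * Real.pi)⁻¹ ^ (3 + j)
      * ∑' v : Fin 3 → ℤ, (intNorm v)⁻¹ ^ (4 + j) := by
  have hz : (2 * Real.pi) ^ (-(j : ℤ) - 3) = (2 * Real.pi)⁻¹ ^ (3 + j) := by
    rw [inv_pow, ← zpow_natCast, ← zpow_neg]
    congr 1
    push_cast
    ring
  rw [coeff, (hasSum_coeffTerm j).tsum_eq, hz, cos_nat_mul_pi_div_two]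
  split_ifs <;> ring

/-- The coefficient of the lattice frequency `v` in the almost periodic factor. -/
noncomputable def cosWeight (k : ℕ) (v : Fin 3 → ℤ) : ℝ :=
  2 * (2 * Real.pi)⁻¹ ^ (k + 1) * (intNorm v)⁻¹ ^ (k + 2)

/-- The coefficient of the lattice frequency `v` in the bounded remainder. -/
noncomputable def sinWeight (k : ℕ) (v : Fin 3 → ℤ) : ℝ :=
  2 * (k + 1) * (2 * Real.pi)⁻¹ ^ (k + 2) * (intNorm v)⁻¹ ^ (k + 3)

/-- The phase at frequency `v`. -/
noncomputable def phase (k : ℕ) (v : Fin 3 → ℤ) (S : ℝ) : ℝ :=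
  2 * Real.pi * intNorm v * S - k * (Real.pi / 2)

lemma cosWeight_nonneg (k : ℕ) (v : Fin 3 → ℤ) : 0 ≤ cosWeight k v := by
  have := intNorm_nonneg v
  unfold cosWeight
  positivity

lemma sinWeight_nonneg (k : ℕ) (v : Fin 3 → ℤ) : 0 ≤ sinWeight k v := by
  have := intNorm_nonneg v
  unfold sinWeight
  positivity

lemma summable_cosWeight {k : ℕ} (hk : 2 ≤ k) : Summable (cosWeight k) :=
  (summable_inv_intNorm_pow (by omega)).mul_left _

lemma summable_sinWeight {k : ℕ} (hk : 2 ≤ k) : Summable (sinWeight k) :=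
  (summable_inv_intNorm_pow (by omega)).mul_left _

lemma summable_cosWeight_mul_cos {k : ℕ} (hk : 2 ≤ k) (S : ℝ) :
    Summable fun v => cosWeight k v * Real.cos (phase k v S) := by
  refine Summable.of_norm_bounded (summable_cosWeight hk) fun v => ?_
  rw [norm_mul, Real.norm_of_nonneg (cosWeight_nonneg k v)]
  exact mul_le_of_le_one_right (cosWeight_nonneg k v) (Real.abs_cos_le_one _)

lemma summable_sinWeight_mul_sin {k : ℕ} (hk : 2 ≤ k) (S : ℝ) :
    Summable fun v => sinWeight k v * Real.sin (phase k v S) := by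
  refine Summable.of_norm_bounded (summable_sinWeight hk) fun v => ?_
  rw [norm_mul, Real.norm_of_nonneg (sinWeight_nonneg k v)]
  exact mul_le_of_le_one_right (sinWeight_nonneg k v) (Real.abs_sin_le_one _)

/-- The almost periodic factor of the linear term. -/
noncomputable def cosSum (k : ℕ) (S : ℝ) : ℝ := ∑' v, cosWeight k v * Real.cos (phase k v S)

/-- The bounded oscillating remainder. -/
noncomputable def sinSum (k : ℕ) (S : ℝ) : ℝ := ∑' v, sinWeight k v * Real.sin (phase k v S)

lemma hasSum_polyPart (k : ℕ) (S : ℝ) :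
    HasSum (fun v : Fin 3 → ℤ => 2 * (intNorm v)⁻¹ * polyPart (2 * Real.pi * intNorm v) k S)
      (∑ i ∈ Finset.range k, coeff i * (S ^ (k - 1 - i) / ((k - 1 - i).factorial : ℝ))) := by
  have : ∀ i ∈ Finset.range k, HasSum (fun v : Fin 3 → ℤ =>
      (2 * (i : ℝ) + 4) * Real.cos (i * (Real.pi / 2)) * (2 * Real.pi)⁻¹ ^ (3 + i)
        * (intNorm v)⁻¹ ^ (4 + i) * (S ^ (k - 1 - i) / ((k - 1 - i).factorial : ℝ)))
      (coeff i * (S ^ (k - 1 - i) / ((k - 1 - i).factorial : ℝ))) := fun i _ => by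
    rw [coeff_eq]
    exact ((summable_inv_intNorm_pow (by omega)).hasSum.mul_left _).mul_right _
  refine (hasSum_sum this).congr_fun fun v => ?_
  rw [polyPart, Finset.mul_sum]
  refine Finset.sum_congr rfl fun i _ => ?_
  rw [mul_inv, mul_pow, show 4 + i = (3 + i) + 1 by ring, pow_succ _ (3 + i)]
  ring

lemma hasSum_oscPart {k : ℕ} (hk : 2 ≤ k) (S : ℝ) :
    HasSum (fun v : Fin 3 → ℤ => 2 * (intNorm v)⁻¹ * oscPart (2 * Real.pi * intNorm v) k S)
      (-(S * cosSum k S) + sinSum k S) := by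
  refine ((((summable_cosWeight_mul_cos hk S).hasSum.mul_left S).neg).add
    (summable_sinWeight_mul_sin hk S).hasSum).congr_fun fun v => ?_
  simp only [oscPart, phase, cosWeight, sinWeight]
  rw [mul_inv, mul_pow, mul_pow]
  ring

/-- The profile `(S - r)_+^k / k!`. -/
noncomputable def profile (k : ℕ) (S r : ℝ) : ℝ := max (S - r) 0 ^ k / (k.factorial : ℝ)

lemma continuous_profile (k : ℕ) (S : ℝ) : Continuous (profile k S) := by
  unfold profile
  fun_prop

lemma profile_eq_zero {k : ℕ} (hk : k ≠ 0) {S r : ℝ} (h : S ≤ r) : profile k S r = 0 := by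
  simp [profile, max_eq_right (sub_nonpos.2 h), hk]

lemma integral_profile_mul (k : ℕ) {S : ℝ} (hS : 0 ≤ S) (g : ℝ → ℝ) :
    ∫ r in (0 : ℝ)..S, profile k S r * g r
      = ∫ r in (0 : ℝ)..S, (S - r) ^ k / (k.factorial : ℝ) * g r := by
  refine intervalIntegral.integral_congr fun r hr => ?_
  rw [uIcc_of_le hS] at hr
  simp only [profile, max_eq_left (sub_nonneg.2 hr.2)]

/-- The Fourier transform of `x ↦ (S - |x|)_+^k / k!` at integer frequencies. -/
lemma radialFourier_profile {k : ℕ} (hk : k ≠ 0) {S : ℝ} (hS : 0 ≤ S) (v : Fin 3 → ℤ) :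
    radialFourier (profile k S) (WithLp.toLp 2 (fun i => (v i : ℝ)))
      = (((if v = 0 then 8 * Real.pi / ((3 + k).factorial : ℝ) * S ^ (3 + k) else 0)
        + (2 * (intNorm v)⁻¹ * polyPart (2 * Real.pi * intNorm v) k S
          + 2 * (intNorm v)⁻¹ * oscPart (2 * Real.pi * intNorm v) k S) : ℝ) : ℂ) := by
  -- At `v = 0` the polynomial and oscillating terms vanish since `(intNorm 0)⁻¹ = 0`.
  by_cases hv : v = 0
  · subst hv
    have h0 : (WithLp.toLp 2 (fun i => (((0 : Fin 3 → ℤ) i : ℤ) : ℝ)) : EuclideanSpace ℝ (Fin 3))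
        = 0 := by ext i; simp
    rw [h0, radialFourier_zero _ hS fun r hr => profile_eq_zero hk hr]
    simp_rw [mul_comm (_ ^ 2) (profile k S _)]
    rw [integral_profile_mul k hS, integral_sub_pow_mul_sq, intNorm_zero]
    simp
    ring
  · have hn := one_le_intNorm hv
    have hv' : (WithLp.toLp 2 (fun i => (v i : ℝ)) : EuclideanSpace ℝ (Fin 3)) ≠ 0 := by
      rw [← norm_pos_iff]
      exact lt_of_lt_of_le one_pos hn
    rw [radialFourier_eq_sine (continuous_profile k S) hS (fun r hr => profile_eq_zero hk hr) hv']
    congr 1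
    change 2 / intNorm v * (∫ r in (0 : ℝ)..S, profile k S r
      * (r * Real.sin (2 * Real.pi * intNorm v * r))) = _
    rw [integral_profile_mul k hS, integral_sub_pow_mul_sin (by positivity), if_neg hv]
    ring

/-- The exact expansion of `N_{3,k}`, obtained by Poisson summation. -/
theorem iteratedCount_eq_expansion {k : ℕ} (hk : 2 ≤ k) {S : ℝ} (hS : 0 ≤ S) :
    iteratedCount k S = 8 * Real.pi / ((3 + k).factorial : ℝ) * S ^ (3 + k)
      + ∑ i ∈ Finset.range k, coeff i * (S ^ (k - 1 - i) / ((k - 1 - i).factorial : ℝ))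
      + (-(S * cosSum k S) + sinSum k S) := by
  have hk0 : k ≠ 0 := by omega
  set c : (Fin 3 → ℤ) → ℝ := fun v =>
    (if v = 0 then 8 * Real.pi / ((3 + k).factorial : ℝ) * S ^ (3 + k) else 0)
        + (2 * (intNorm v)⁻¹ * polyPart (2 * Real.pi * intNorm v) k S
          + 2 * (intNorm v)⁻¹ * oscPart (2 * Real.pi * intNorm v) k S)
  have hc : HasSum c (8 * Real.pi / ((3 + k).factorial : ℝ) * S ^ (3 + k)
      + (∑ i ∈ Finset.range k, coeff i * (S ^ (k - 1 - i) / ((k - 1 - i).factorial : ℝ))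
      + (-(S * cosSum k S) + sinSum k S))) :=
    (hasSum_ite_eq 0 _).add ((hasSum_polyPart k S).add (hasSum_oscPart hk S))
  have hP := hasSum_fourier_of_boundedSupport
    (f := fun x : Fin 3 → ℝ =>
      (profile k S ‖(WithLp.toLp 2 x : EuclideanSpace ℝ (Fin 3))‖ : ℂ)) (B := S)
    (c := fun v => (c v : ℂ))
    (Complex.continuous_ofReal.comp ((continuous_profile k S).comp (by fun_prop)))
    (fun x hx => abs_le_of_radial_ne_zero (fun r hr => profile_eq_zero hk0 hr)
      (Complex.ofReal_ne_zero.1 hx))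
    (fun v => by rw [← radialFourier_profile hk0 hS, radialFourier_eq_integral])
    (Complex.summable_ofReal.2 hc.summable)
  rw [← Complex.ofReal_tsum, Complex.hasSum_ofReal] at hP
  have h := hP.unique hc
  rw [iteratedCount_eq_tsum k hS, add_assoc, ← h]
  refine tsum_congr fun v => ?_
  obtain ⟨m, rfl⟩ : ∃ m, k = m + 1 := ⟨k - 1, by omega⟩
  exact truncPow_succ_eq m _ _

/-- The expansion of `N_{3,k}` in terms of its main part. -/
theorem iteratedCount_sub_mainPart {k : ℕ} (hk : 2 ≤ k) {S : ℝ} (hS : 0 ≤ S) :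
    iteratedCount k S - mainPart k S
      = (coeff (k - 2) - cosSum k S) * S + (coeff (k - 1) + sinSum k S) := by
  obtain ⟨m, rfl⟩ : ∃ m, k = m + 2 := ⟨k - 2, by omega⟩
  -- Reflection orders the sum by powers of `S`; the two splits remove `S ^ 0` and `S ^ 1`, which
  -- `mainPart` omits.
  rw [iteratedCount_eq_expansion hk hS, mainPart, ← Finset.sum_range_reflect,
    Finset.sum_range_succ', Finset.sum_range_succ']
  have hsum : ∑ i ∈ Finset.Icc 2 (m + 2 - 1),
      coeff (m + 2 - 1 - i) / (i.factorial : ℝ) * S ^ i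
      = ∑ i ∈ Finset.range m, coeff (m + 2 - 1 - (i + 1 + 1)) * (S ^ (m + 2 - 1 -
        (m + 2 - 1 - (i + 1 + 1))) / ((m + 2 - 1 - (m + 2 - 1 - (i + 1 + 1))).factorial : ℝ)) := by
    rw [← Finset.Ico_succ_right_eq_Icc, Finset.sum_Ico_eq_sum_range]
    refine Finset.sum_congr (by simp) fun i hi => ?_
    have : i < m := by simpa using hi
    rw [show m + 2 - 1 - (m + 2 - 1 - (i + 1 + 1)) = 2 + i by omega,
      show i + 1 + 1 = 2 + i by ring]
    ring
  rw [hsum]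
  simp
  ring

end LatticeSums

/-! ### The linear error bound -/

section Bounds

lemma abs_cosSum_le {k : ℕ} (hk : 2 ≤ k) (S : ℝ) : |cosSum k S| ≤ ∑' v, cosWeight k v := by
  rw [← Real.norm_eq_abs]
  refine tsum_of_norm_bounded (summable_cosWeight hk).hasSum fun v => ?_
  rw [norm_mul, Real.norm_of_nonneg (cosWeight_nonneg k v)]
  exact mul_le_of_le_one_right (cosWeight_nonneg k v) (Real.abs_cos_le_one _)

lemma abs_sinSum_le {k : ℕ} (hk : 2 ≤ k) (S : ℝ) : |sinSum k S| ≤ ∑' v, sinWeight k v := by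
  rw [← Real.norm_eq_abs]
  refine tsum_of_norm_bounded (summable_sinWeight hk).hasSum fun v => ?_
  rw [norm_mul, Real.norm_of_nonneg (sinWeight_nonneg k v)]
  exact mul_le_of_le_one_right (sinWeight_nonneg k v) (Real.abs_sin_le_one _)

/-- Only the origin is counted. This serves near `S = 0`, where bounding the two sums in the
expansion separately gives `O(1)` and not `O(S)`. -/
lemma iteratedCount_of_lt_one (k : ℕ) {S : ℝ} (hS : 0 ≤ S) (hS1 : S < 1) :
    iteratedCount k S = S ^ k / (k.factorial : ℝ) := by
  rw [iteratedCount_eq_tsum k hS, tsum_eq_single 0 fun v hv => ?_]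
  · simp [truncPow, intNorm_zero, hS]
  · rw [truncPow, if_neg (not_le.2 (hS1.trans_le (one_le_intNorm hv)))]

lemma pow_le_self_of_le_one {S : ℝ} (hS : 0 ≤ S) (hS1 : S ≤ 1) {m : ℕ} (hm : m ≠ 0) :
    S ^ m ≤ S := by
  simpa using pow_le_pow_of_le_one hS hS1 (Nat.one_le_iff_ne_zero.2 hm)

lemma abs_mainPart_le (k : ℕ) {S : ℝ} (hS : 0 ≤ S) (hS1 : S ≤ 1) :
    |mainPart k S| ≤ (8 * Real.pi / ((3 + k).factorial : ℝ)
      + ∑ m ∈ Finset.Icc 2 (k - 1), |coeff (k - 1 - m) / (m.factorial : ℝ)|) * S := by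
  rw [mainPart, add_mul, Finset.sum_mul]
  refine (abs_add_le _ _).trans (add_le_add ?_ ?_)
  · rw [abs_of_nonneg (by positivity)]
    have := pow_le_self_of_le_one hS hS1 (m := 3 + k) (by omega)
    gcongr
  · refine (Finset.abs_sum_le_sum_abs _ _).trans (Finset.sum_le_sum fun m hm => ?_)
    have h2 := (Finset.mem_Icc.1 hm).1
    rw [abs_mul, abs_of_nonneg (pow_nonneg hS m)]
    have := pow_le_self_of_le_one hS hS1 (m := m) (by omega)
    gcongr

/-- The linear error bound for `N_{3,k}`. -/
theorem exists_abs_iteratedCount_sub_mainPart_le {k : ℕ} (hk : 2 ≤ k) :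
    ∃ A : ℝ, ∀ S : ℝ, 0 ≤ S → |iteratedCount k S - mainPart k S| ≤ A * S := by
  set A₁ := |coeff (k - 2)| + (∑' v, cosWeight k v) + (|coeff (k - 1)| + ∑' v, sinWeight k v)
  set A₂ := 1 + (8 * Real.pi / ((3 + k).factorial : ℝ)
      + ∑ m ∈ Finset.Icc 2 (k - 1), |coeff (k - 1 - m) / (m.factorial : ℝ)|)
  refine ⟨max A₁ A₂, fun S hS => ?_⟩
  rcases lt_or_ge S 1 with h | h
  · refine le_trans ?_ (mul_le_mul_of_nonneg_right (le_max_right _ _) hS)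
    rw [iteratedCount_of_lt_one k hS h]
    refine (abs_sub _ _).trans ?_
    rw [add_mul, one_mul]
    refine add_le_add ?_ (abs_mainPart_le k hS h.le)
    rw [abs_of_nonneg (by positivity)]
    exact (div_le_self (by positivity) (by exact_mod_cast k.factorial_pos)).trans
      (pow_le_self_of_le_one hS h.le (by omega))
  · refine le_trans ?_ (mul_le_mul_of_nonneg_right (le_max_left _ _) hS)
    rw [iteratedCount_sub_mainPart hk hS, add_mul]
    refine (abs_add_le _ _).trans (add_le_add ?_ ?_)
    · rw [abs_mul, abs_of_nonneg hS]
      exact mul_le_mul_of_nonneg_right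
        ((abs_sub _ _).trans (add_le_add le_rfl (abs_cosSum_le hk S))) hS
    · refine (abs_add_le _ _).trans ((add_le_add le_rfl (abs_sinSum_le hk S)).trans ?_)
      exact le_mul_of_one_le_right
        (add_nonneg (abs_nonneg _) (tsum_nonneg (sinWeight_nonneg k))) h

end Bounds

/-! ### Mean values and non-convergence of the almost periodic factor -/

section AlmostPeriodic

open Filter Topology MeasureTheory Set

lemma tendsto_integral_cos_dilation {c : ℝ} (hc : c ≠ 0) (φ : ℝ) :
    Tendsto (fun T : ℝ => ∫ s in (0 : ℝ)..1, Real.cos (c * (T * s) - φ)) atTop (𝓝 0) := by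
  have hval : ∀ T : ℝ, 0 < T → ∫ s in (0 : ℝ)..1, Real.cos (c * (T * s) - φ)
      = (Real.sin (c * T - φ) - Real.sin (-φ)) * (c * T)⁻¹ := fun T hT => by
    have hne : c * T ≠ 0 := mul_ne_zero hc hT.ne'
    simp_rw [← mul_assoc]
    rw [intervalIntegral.integral_comp_mul_sub (fun x => Real.cos x) hne φ, integral_cos]
    simp
    ring
  have hlim : Tendsto (fun T : ℝ => (c * T)⁻¹) atTop (𝓝 0) := by
    simp_rw [mul_inv]
    simpa using tendsto_inv_atTop_zero.const_mul c⁻¹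
  have hbdd : IsBoundedUnder (· ≤ ·) atTop
      (norm ∘ fun T : ℝ => Real.sin (c * T - φ) - Real.sin (-φ)) :=
    isBoundedUnder_of ⟨1 + 1, fun T =>
      (abs_sub _ _).trans (add_le_add (Real.abs_sin_le_one _) (Real.abs_sin_le_one _))⟩
  refine (isBoundedUnder_le_mul_tendsto_zero hbdd hlim).congr' ?_
  filter_upwards [eventually_gt_atTop 0] with T hT
  exact (hval T hT).symm

/-- Dilation averages of a bounded continuous function vanishing at infinity tend to zero. -/
lemma tendsto_integral_dilation {h : ℝ → ℝ} (hc : Continuous h) {M : ℝ} (hM : ∀ x, |h x| ≤ M)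
    (hlim : Tendsto h atTop (𝓝 0)) :
    Tendsto (fun T : ℝ => ∫ s in (0 : ℝ)..1, h (T * s)) atTop (𝓝 0) := by
  have := intervalIntegral.tendsto_integral_filter_of_dominated_convergence (a := 0) (b := 1)
    (μ := volume) (l := atTop) (F := fun T s => h (T * s)) (f := fun _ => 0) (fun _ => M)
    (Eventually.of_forall fun T => (hc.comp (by fun_prop)).aestronglyMeasurable)
    (Eventually.of_forall fun T => Eventually.of_forall fun s _ => hM _)
    intervalIntegrable_const
    (Eventually.of_forall fun s hs => by
      rw [uIoc_of_le zero_le_one] at hs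
      exact hlim.comp (tendsto_id.atTop_mul_const hs.1))
  simpa using this

/-- The mean value of `cos (a S - φ) cos (b S - φ)`. -/
lemma tendsto_integral_cos_mul_cos {a b : ℝ} (ha : 0 ≤ a) (hb : 0 < b) (φ : ℝ) :
    Tendsto (fun T : ℝ => ∫ s in (0 : ℝ)..1,
      Real.cos (a * (T * s) - φ) * Real.cos (b * (T * s) - φ)) atTop
      (𝓝 (if a = b then 1 / 2 else 0)) := by
  have hprod : ∀ T : ℝ, ∫ s in (0 : ℝ)..1,
      Real.cos (a * (T * s) - φ) * Real.cos (b * (T * s) - φ)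
      = 1 / 2 * ((∫ s in (0 : ℝ)..1, Real.cos ((a - b) * (T * s) - 0))
        + ∫ s in (0 : ℝ)..1, Real.cos ((a + b) * (T * s) - 2 * φ)) := fun T => by
    rw [← intervalIntegral.integral_add (by apply Continuous.intervalIntegrable; fun_prop)
      (by apply Continuous.intervalIntegrable; fun_prop), ← intervalIntegral.integral_const_mul]
    refine intervalIntegral.integral_congr fun s _ => ?_
    have h1 := Real.cos_add (a * (T * s) - φ) (b * (T * s) - φ)
    have h2 := Real.cos_sub (a * (T * s) - φ) (b * (T * s) - φ)
    rw [show (a - b) * (T * s) - 0 = a * (T * s) - φ - (b * (T * s) - φ) by ring,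
      show (a + b) * (T * s) - 2 * φ = a * (T * s) - φ + (b * (T * s) - φ) by ring, h1, h2]
    ring
  simp_rw [hprod]
  have h2 := tendsto_integral_cos_dilation (show a + b ≠ 0 by positivity) (2 * φ)
  split_ifs with hab
  · subst hab
    simpa using (tendsto_const_nhds (x := (1 : ℝ)).add h2).const_mul (2⁻¹ : ℝ)
  · simpa using ((tendsto_integral_cos_dilation (sub_ne_zero.2 hab) 0).add h2).const_mul (2⁻¹ : ℝ)

lemma continuous_cosSum {k : ℕ} (hk : 2 ≤ k) : Continuous (cosSum k) := by
  refine continuous_tsum (fun v => by unfold phase; fun_prop) (summable_cosWeight hk)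
    fun v S => ?_
  rw [norm_mul, Real.norm_of_nonneg (cosWeight_nonneg k v)]
  exact mul_le_of_le_one_right (cosWeight_nonneg k v) (Real.abs_cos_le_one _)

/-- The almost periodic factor does not converge. -/
theorem not_tendsto_cosSum {k : ℕ} (hk : 2 ≤ k) (β : ℝ) :
    ¬ Tendsto (cosSum k) atTop (𝓝 β) := by
  intro hlim
  -- The shift `φ` is the same for all `v`, so a single test cosine of frequency `b` is in phase
  -- with every term having `intNorm v = 1`.
  obtain ⟨φ, b, hb, hphase⟩ : ∃ φ b : ℝ, 0 < b ∧
      ∀ v S, phase k v S = b * intNorm v * S - φ :=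
    ⟨k * (Real.pi / 2), 2 * Real.pi, by positivity, fun _ _ => rfl⟩
  have hlim0 : Tendsto (fun S => (cosSum k S - β) * Real.cos (b * S - φ)) atTop (𝓝 0) := by
    refine Tendsto.zero_mul_isBoundedUnder_le (by simpa using hlim.sub_const β) ?_
    exact isBoundedUnder_of ⟨1, fun S => Real.abs_cos_le_one _⟩
  have hmean := tendsto_integral_dilation (h := fun S => (cosSum k S - β) * Real.cos (b * S - φ))
    (M := (∑' v, cosWeight k v) + |β|)
    (((continuous_cosSum hk).sub continuous_const).mul (by fun_prop)) (fun S => by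
      rw [abs_mul]
      exact (mul_le_of_le_one_right (abs_nonneg _) (Real.abs_cos_le_one _)).trans
        ((abs_sub _ _).trans (add_le_add (abs_cosSum_le hk S) le_rfl))) hlim0
  set m : ℝ → (Fin 3 → ℤ) → ℝ := fun T v => ∫ s in (0 : ℝ)..1,
    cosWeight k v * (Real.cos (b * intNorm v * (T * s) - φ) * Real.cos (b * (T * s) - φ))
  have hswap : ∀ T : ℝ, HasSum (m T) (∫ s in (0 : ℝ)..1,
      cosSum k (T * s) * Real.cos (b * (T * s) - φ)) := fun T => by
    refine intervalIntegral.hasSum_integral_of_dominated_convergence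
      (fun v _ => cosWeight k v) (fun v => Continuous.aestronglyMeasurable (by fun_prop))
      (fun v => Eventually.of_forall fun s _ => ?_)
      (Eventually.of_forall fun s _ => summable_cosWeight hk) intervalIntegrable_const
      (Eventually.of_forall fun s _ => ?_)
    · rw [norm_mul, norm_mul, Real.norm_of_nonneg (cosWeight_nonneg k v)]
      exact mul_le_of_le_one_right (cosWeight_nonneg k v)
        (mul_le_one₀ (Real.abs_cos_le_one _) (norm_nonneg _) (Real.abs_cos_le_one _))
    · refine ((summable_cosWeight_mul_cos hk (T * s)).hasSum.mul_right _).congr_fun fun v => ?_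
      rw [hphase, ← mul_assoc (cosWeight k v)]
  have hsplit : ∀ T : ℝ, ∫ s in (0 : ℝ)..1,
      (fun S => (cosSum k S - β) * Real.cos (b * S - φ)) (T * s)
      = ∑' v, m T v - β * ∫ s in (0 : ℝ)..1, Real.cos (b * (T * s) - φ) := fun T => by
    rw [(hswap T).tsum_eq, ← intervalIntegral.integral_const_mul, ← intervalIntegral.integral_sub]
    · exact intervalIntegral.integral_congr fun s _ => by simp only; ring
    · exact (((continuous_cosSum hk).comp (by fun_prop)).mul
        (by fun_prop)).intervalIntegrable _ _
    · apply Continuous.intervalIntegrable; fun_prop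
  have hterm : ∀ v, Tendsto (fun T => m T v) atTop
      (𝓝 (cosWeight k v * if b * intNorm v = b then 1 / 2 else 0)) := fun v => by
    simp only [m, intervalIntegral.integral_const_mul]
    exact (tendsto_integral_cos_mul_cos (mul_nonneg hb.le (intNorm_nonneg v)) hb φ).const_mul _
  have hsum := tendsto_tsum_of_dominated_convergence (summable_cosWeight hk) hterm
    (Eventually.of_forall fun T v => by
      refine (intervalIntegral.norm_integral_le_of_norm_le_const
        (C := cosWeight k v) fun s _ => ?_).trans (by simp)
      rw [norm_mul, norm_mul, Real.norm_of_nonneg (cosWeight_nonneg k v)]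
      exact mul_le_of_le_one_right (cosWeight_nonneg k v)
        (mul_le_one₀ (Real.abs_cos_le_one _) (norm_nonneg _) (Real.abs_cos_le_one _)))
  have hfin := hsum.sub ((tendsto_integral_cos_dilation hb.ne' φ).const_mul β)
  simp_rw [hsplit] at hmean
  -- The same mean is 0 by the assumed convergence and a sum of nonnegative terms by termwise
  -- integration.
  have heq := tendsto_nhds_unique hmean hfin
  rw [mul_zero, sub_zero] at heq
  have hnn : ∀ v, 0 ≤ cosWeight k v * if b * intNorm v = b then (1 / 2 : ℝ) else 0 := fun v =>
    mul_nonneg (cosWeight_nonneg k v) (by split_ifs <;> norm_num)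
  have hsm : Summable fun v => cosWeight k v * if b * intNorm v = b then (1 / 2 : ℝ) else 0 :=
    Summable.of_nonneg_of_le hnn (fun v => mul_le_of_le_one_right (cosWeight_nonneg k v)
      (by split_ifs <;> norm_num)) (summable_cosWeight hk)
  have hone : intNorm (Pi.single 0 1 : Fin 3 → ℤ) = 1 := by
    rw [← sq_eq_sq₀ (intNorm_nonneg _) zero_le_one, intNorm_sq]
    simp [Fin.sum_univ_three]
  have hpos : 0 < cosWeight k (Pi.single 0 1)
      * if b * intNorm (Pi.single 0 1 : Fin 3 → ℤ) = b then (1 / 2 : ℝ) else 0 := by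
    rw [hone, mul_one, if_pos rfl, cosWeight, hone]
    positivity
  exact (hsm.tsum_pos hnn _ hpos).ne heq

/-- The linear term of the error is not asymptotically a multiple of `S`. -/
theorem not_exists_isBigO_linear {k : ℕ} (hk : 2 ≤ k) :
    ¬ ∃ ε : ℝ, 0 < ε ∧ ∃ α : ℝ,
      Asymptotics.IsBigO atTop
        (fun S : ℝ => iteratedCount k S - mainPart k S - α * S)
        (fun S : ℝ => S ^ (1 - ε)) := by
  rintro ⟨ε, hε, α, hO⟩
  refine not_tendsto_cosSum hk (coeff (k - 2) - α) ?_
  -- Division by `S` leaves `O(S^{-ε})`, so `cosSum k` would tend to `coeff (k - 2) - α`.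
  have h1 : Tendsto (fun S : ℝ => (iteratedCount k S - mainPart k S - α * S) * S⁻¹) atTop (𝓝 0) := by
    have h := hO.mul (Asymptotics.isBigO_refl (fun S : ℝ => S⁻¹) atTop)
    refine h.trans_tendsto ((tendsto_rpow_neg_atTop hε).congr' ?_)
    filter_upwards [eventually_gt_atTop 0] with S hS
    rw [← Real.rpow_neg_one, ← Real.rpow_add hS]
    congr 1
    ring
  have h2 : Tendsto (fun S : ℝ => (coeff (k - 1) + sinSum k S) * S⁻¹) atTop (𝓝 0) := by
    simp_rw [mul_comm _ (_⁻¹)]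
    refine tendsto_inv_atTop_zero.zero_mul_isBoundedUnder_le
      (isBoundedUnder_of ⟨|coeff (k - 1)| + ∑' v, sinWeight k v, fun S => ?_⟩)
    exact (abs_add_le _ _).trans (add_le_add le_rfl (abs_sinSum_le hk S))
  have h3 := (h2.sub h1).const_add (coeff (k - 2) - α)
  rw [sub_zero, add_zero] at h3
  refine h3.congr' ?_
  filter_upwards [eventually_gt_atTop 0] with S hS
  rw [iteratedCount_sub_mainPart hk hS.le]
  field_simp
  ring

end AlmostPeriodic

end GaussSphere

theorem corollary3 :
    (∀ j : ℕ, Summable (GaussSphere.coeffTerm j)) ∧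
    ∀ k : ℕ, 2 ≤ k →
      (∃ A : ℝ, ∀ S : ℝ, 0 ≤ S →
        |GaussSphere.iteratedCount k S - GaussSphere.mainPart k S| ≤ A * S) ∧
      ¬ ∃ ε : ℝ, 0 < ε ∧ ∃ α : ℝ,
        Asymptotics.IsBigO Filter.atTop
          (fun S : ℝ => GaussSphere.iteratedCount k S - GaussSphere.mainPart k S - α * S)
          (fun S : ℝ => S ^ (1 - ε)) :=
  ⟨GaussSphere.summable_coeffTerm, fun _ hk =>
    ⟨GaussSphere.exists_abs_iteratedCount_sub_mainPart_le hk,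
      GaussSphere.not_exists_isBigO_linear hk⟩⟩
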